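/- Let $\varepsilon\in\{+1,-1\}$, let $t\neq 0$ be real, and let $$\theta=\begin{pmatrix}0&-t&0&0\\ t&0&0&0\\ 0&0&0&-\varepsilon t\\ 0&0&\varepsilon t&0\end{pmatrix},\qquad B=\theta^{-1},\qquad J=-\tfrac1t\,\theta .$$ Here $J$ is the constant complex structure on $\mathbb R^4\cong\mathbb C^2$ with holomorphic coordinates $z_1=x^2+ix^1$, $z_2=x^4+\varepsilon i x^3$. A skew-symmetric matrix field $M$ is identified with the two-form $\tfrac12 M_{ab}\,dx^a\wedge dx^b$; repeated indices are summed. Let $U\subset\mathbb R^4$ be open and let $g$ be a smooth, symmetric, nondegenerate (possibly indefinite) metric on $U$, Hermitian with respect to $J$ (that is, $J^{T}gJ=g$), with $\det(g+E_4)\ne0$ on $U$. Put $$F=\tfrac12\,(g-E_4)\,\theta^{-1},\qquad\text{that is,}\qquad g=2F\theta+E_4 .$$ Then $F$ is skew-symmetric and $B+F$ is invertible on $U$. Let $\Theta=(B+F)^{-1}$, $\{u,v\}_\Theta=\Theta^{ab}\,\partial_a u\,\partial_b v$, $\phi_a=B_{ab}x^b$, $D_a h=\{\phi_a,h\}_\Theta$,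 and let $f=(1+F\theta)^{-1}F$ be the image of $F$ under the exact Seiberg–Witten map. The metric $g$ is called Kähler on $U$ if its fundamental two-form $\Omega(u,v)=g(Ju,v)$ is closed. 1. The metric $g$ is Kähler on $U$ if and only if $dF=0$ on $U$. 2. The metric $g$ is Kähler on $U$ if and only if the Bianchi identity $D_af_{bc}+D_bf_{ca}+D_cf_{ab}=0$ holds on $U$ for all $a,b,c$. 3. On $U$ one has $f_{ab}=B_{ab}+\{\phi_a,\phi_b\}_\Theta$, the matrix $1-f\theta$ is invertible, and $F=(1-f\theta)^{-1}f$. 4. Let $V\subset\mathbb R^4$ be open and let $\varphi:V\to U$, $y\mapsto x(y)$, be a diffeomorphism with $\varphi^*(B+F)=B$ (a Darboux transformation). Let $\{u,v\}_\theta=\theta^{\mu\nu}\frac{\partial u}{\partial y^\mu}\frac{\partial v}{\partial y^\nu}$, and let $a_\mu$ be the symplectic gauge field defined by $B_{\mu\nu}x^\nu(y)=B_{\mu\nu}y^\nu+a_\mu(y)$, with field strength $f^{\rm sym}_{\mu\nu}=\partial_\mu a_\nu-\partial_\nu a_\mu+\{a_\mu,a_\nu\}_\theta$ and covariant derivative $D^{\rm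 sym}_\mu h=\partial_\mu h+\{a_\mu,h\}_\theta$. Then on $V$ $$f^{\rm sym}(y)=\big((1+F\theta)^{-1}F\big)(x(y)),\quad F(x(y))=\big((1-f^{\rm sym}\theta)^{-1}f^{\rm sym}\big)(y),\quad (D^{\rm sym}_a f^{\rm sym}_{bc})(y)=(D_af_{bc})(x(y)),$$ and $g$ is Kähler on $U$ if and only if $D^{\rm sym}_af^{\rm sym}_{bc}+D^{\rm sym}_bf^{\rm sym}_{ca}+D^{\rm sym}_cf^{\rm sym}_{ab}=0$ on $V$ for all $a,b,c$. -/

import Mathlib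

open Matrix
open scoped ContDiff

noncomputable section

namespace SWKahler

/-- Coordinate space `ℝ⁴`; the indices `0, 1, 2, 3` stand for the coordinates `x¹, x², x³, x⁴`. -/
abbrev R4 : Type := Fin 4 → ℝ

/-- Real `4 × 4` matrices. -/
abbrev M4 : Type := Matrix (Fin 4) (Fin 4) ℝ

/-- The constant (anti-)self-dual matrix with parameter `t`:
`ε = 1` gives the self-dual one, `ε = -1` the anti-self-dual one. -/
def thetaMat (ε : ℤˣ) (t : ℝ) : M4 :=
  !![0, -t, 0, 0;
     t, 0, 0, 0;
     0, 0, 0, -(((ε : ℤ) : ℝ) * t);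
     0, 0, ((ε : ℤ) : ℝ) * t, 0]

/-- The constant background two-form `B = θ⁻¹`. -/
def bgB (ε : ℤˣ) (t : ℝ) : M4 := (thetaMat ε t)⁻¹

/-- The constant complex structure of `ℂ² ≅ ℝ⁴` (acting on column vectors) with holomorphic
coordinates `z₁ = x² + i x¹` and `z₂ = x⁴ + ε i x³`, so that `J ∂₂ = ∂₁`, `J ∂₁ = -∂₂`,
`J ∂₄ = ε ∂₃`, `J ∂₃ = -ε ∂₄`. -/
def cplxJ (ε : ℤˣ) : M4 :=
  !![0, 1, 0, 0;
     -1, 0, 0, 0;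
     0, 0, 0, ((ε : ℤ) : ℝ);
     0, 0, -((ε : ℤ) : ℝ), 0]

/-- The constant two-form `½ ∑ M_{ab} dx^a ∧ dx^b`. For skew-symmetric `M` its value on `(u, v)` is
`∑ M_{ab} u^a v^b`. -/
def twoForm (M : M4) : R4 [⋀^Fin 2]→L[ℝ] ℝ where
  toFun v := (1 / 2) * ∑ a, ∑ b, M a b * (v 0 a * v 1 b - v 0 b * v 1 a)
  map_update_add' := by
    intro _ v i x y
    rw [← mul_add, ← Finset.sum_add_distrib]
    congr 1
    refine Finset.sum_congr rfl fun a _ => ?_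
    rw [← Finset.sum_add_distrib]
    refine Finset.sum_congr rfl fun b _ => ?_
    fin_cases i <;> simp <;> ring
  map_update_smul' := by
    intro _ v i c x
    simp only [smul_eq_mul, Finset.mul_sum]
    refine Finset.sum_congr rfl fun a _ => Finset.sum_congr rfl fun b _ => ?_
    fin_cases i <;> simp <;> ring
  cont := by fun_prop
  map_eq_zero_of_eq' := by
    intro v i j h hij
    have h01 : v 0 = v 1 := by
      fin_cases i <;> fin_cases j <;> simp_all
    simp [h01, mul_comm]

/-- A field of matrices, read as the two-form `½ ∑ F_{ab}(x) dx^a ∧ dx^b`, is closed on `U`. -/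
def ClosedOn (F : R4 → M4) (U : Set R4) : Prop :=
  ∀ x ∈ U, extDeriv (fun z => twoForm (F z)) x = 0

/-- `g` is a smooth (possibly indefinite) metric on `U`, Hermitian with respect to the
constant complex structure `J`. -/
structure IsHermitianMetricOn (J : M4) (g : R4 → M4) (U : Set R4) : Prop where
  smooth : ∀ a b, ContDiffOn ℝ ∞ (fun x => g x a b) U
  symm : ∀ x ∈ U, (g x)ᵀ = g x
  nondegenerate : ∀ x ∈ U, (g x).det ≠ 0
  compat : ∀ x ∈ U, Jᵀ * g x * J = g x

/-- The matrix field of the fundamental two-form `Ω(u, v) = g(J u, v)`. -/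
def fundForm (J : M4) (g : R4 → M4) : R4 → M4 := fun x => Jᵀ * g x

/-- The Kähler condition for `g` with respect to `J` on `U`: `g` is Hermitian and its
fundamental two-form is closed. -/
def IsKahlerOn (J : M4) (g : R4 → M4) (U : Set R4) : Prop :=
  IsHermitianMetricOn J g U ∧ ClosedOn (fundForm J g) U

/-- Partial derivative in the `i`-th coordinate direction. -/
def pd (i : Fin 4) (u : R4 → ℝ) (x : R4) : ℝ := fderiv ℝ u x (Pi.single i 1)

/-- The bracket `{u, v}_P = P^{ab} ∂_a u ∂_b v` of a bivector field `P`. -/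
def bracket (P : R4 → M4) (u v : R4 → ℝ) (x : R4) : ℝ :=
  ∑ a, ∑ b, P x a b * pd a u x * pd b v x

/-- The exact Seiberg-Witten map `F ↦ f = (1 + F θ)⁻¹ F`. -/
def swMap (θ : M4) (F : M4) : M4 := (1 + F * θ)⁻¹ * F

/-- The inverse Seiberg-Witten map `f ↦ F = (1 - f θ)⁻¹ f`. -/
def swInv (θ : M4) (f : M4) : M4 := (1 - f * θ)⁻¹ * f

/-- The bivector field `Θ = (B + F)⁻¹`. -/
def bivec (B : M4) (F : R4 → M4) : R4 → M4 := fun x => (B + F x)⁻¹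

/-- The covariant coordinates `φ_a = B_{ab} x^b` as functions of `x`. -/
def covCoord (B : M4) (a : Fin 4) : R4 → ℝ := fun x => (B *ᵥ x) a

/-- The covariant derivative `D_a h = {φ_a, h}_Θ`, in the coordinates `x`. -/
def covD (B : M4) (F : R4 → M4) (a : Fin 4) (h : R4 → ℝ) : R4 → ℝ :=
  bracket (bivec B F) (covCoord B a) h

/-- The Bianchi identity `D_a f_{bc} + D_b f_{ca} + D_c f_{ab} = 0` on `V` for a field `f` of
matrices and a family `D` of covariant derivatives. -/
def BianchiOn (D : Fin 4 → (R4 → ℝ) → R4 → ℝ) (f : R4 → M4) (V : Set R4) : Prop :=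
  ∀ x ∈ V, ∀ a b c, D a (fun z => f z b c) x + D b (fun z => f z c a) x
    + D c (fun z => f z a b) x = 0

/-- `φ : V → U`, `y ↦ x(y)`, is a Darboux transformation: a diffeomorphism of `V` onto `U` with
`φ^*(B + F) = B`. -/
structure IsDarboux (B : M4) (F : R4 → M4) (φ : R4 → R4) (V U : Set R4) : Prop where
  smooth : ContDiffOn ℝ ∞ φ V
  bijOn : Set.BijOn φ V U
  smooth_inverse : ∃ ψ : R4 → R4, ContDiffOn ℝ ∞ ψ U ∧ ∀ y ∈ V, ψ (φ y) = y
  pullback : ∀ y ∈ V,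
    (twoForm (B + F (φ y))).compContinuousLinearMap (fderiv ℝ φ y) = twoForm B

/-- The symplectic gauge field `a_μ` of a coordinate transformation `y ↦ x = φ(y)`:
`B_{μν} x^ν(y) = p_μ + a_μ(y)` with `p_μ = B_{μν} y^ν`. -/
def gaugeField (B : M4) (φ : R4 → R4) (μ : Fin 4) : R4 → ℝ :=
  fun y => (B *ᵥ φ y) μ - (B *ᵥ y) μ

/-- The symplectic field strength `f_{μν} = ∂_μ a_ν - ∂_ν a_μ + {a_μ, a_ν}_θ`. -/
def fieldStrength (θ : M4) (A : Fin 4 → R4 → ℝ) (y : R4) : M4 :=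
  Matrix.of fun μ ν =>
    pd μ (A ν) y - pd ν (A μ) y + bracket (fun _ => θ) (A μ) (A ν) y

/-- The symplectic covariant derivative `D_μ h = ∂_μ h + {a_μ, h}_θ`. -/
def gaugeD (θ : M4) (A : Fin 4 → R4 → ℝ) (μ : Fin 4) (h : R4 → ℝ) : R4 → ℝ :=
  fun y => pd μ h y + bracket (fun _ => θ) (A μ) h y

end SWKahler

end

open SWKahler

/-!
Put `ω = B + F`, `Θ = ω⁻¹` and `P = B Θ`. Apart from the comparison of `F` with the fundamental
two-form, only `B θ = 1`, `Bᵀ = -B`, and the skew-symmetry and invertibility of `ω` matter.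

Since `θ = -t J` and a Hermitian `g` commutes with `J`, the fundamental two-form is the constant
form `-J` plus `-2t F` (`fundForm_eq`), so it is closed exactly when `F` is
(`isKahlerOn_iff_closedOn`).

The Seiberg-Witten map takes the form `f = B - B Θ B` (`swMap_eq`). This is `B_{ab} + {φ_a, φ_b}_Θ`,
because `φ_a` is linear with gradient the `a`-th row of `B` and `Bᵀ = -B`; it also gives
`1 - f θ = P`, from which `F` is recovered. Differentiating the inverse matrix,
`∂_q f = P (∂_q F) Pᵀ` (`matPd_swMap`), while `D_a = P_{aq} ∂_q`. Hence
`D_a f_{bc} = P_{aq} P_{bp} P_{cr} ∂_q F_{pr}` (`covD_swMap`): the cyclic sum of the left side is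
the invertible matrix `P` applied to all three indices of the cyclic sum of `∂_q F_{pr}`, and the latter
consists of the components of `dF` (`closedOn_iff`). So one vanishes when the other does.

For a Darboux transformation with Jacobian matrix `A`, the condition `Aᵀ ω A = B` is equivalent to
`Θ = A θ Aᵀ` (`darboux_jacobian`). The gradient of `a_μ` is the `μ`-th row of `B A - B`; expanding
the field strength gives `B - B A θ Aᵀ B`, which is `f` again, and the covariant derivative is
`(B A θ)_{μν} ∂_ν`, which on a function `k ∘ φ` is `(B A θ Aᵀ)_{μq} ∂_q k`, that is `D_μ k`.
-/

noncomputable section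

namespace SWKahler

/-! ### The constant matrices -/

lemma cplxJ_mul_self (ε : ℤˣ) : cplxJ ε * cplxJ ε = -1 := by
  rcases Int.units_eq_one_or ε with rfl | rfl <;> ext i j <;> fin_cases i <;> fin_cases j <;>
    simp [cplxJ, Matrix.mul_apply, Fin.sum_univ_four]

lemma cplxJ_transpose (ε : ℤˣ) : (cplxJ ε)ᵀ = -cplxJ ε := by
  ext i j; fin_cases i <;> fin_cases j <;> simp [cplxJ]

lemma thetaMat_eq (ε : ℤˣ) (t : ℝ) : thetaMat ε t = (-t) • cplxJ ε := by
  ext i j; fin_cases i <;> fin_cases j <;> simp [cplxJ, thetaMat, mul_comm]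

lemma bgB_eq (ε : ℤˣ) {t : ℝ} (ht : t ≠ 0) : bgB ε t = t⁻¹ • cplxJ ε := by
  refine Matrix.inv_eq_left_inv ?_
  rw [thetaMat_eq, smul_mul_smul_comm, cplxJ_mul_self]
  simp [ht]

lemma bgB_mul_thetaMat (ε : ℤˣ) {t : ℝ} (ht : t ≠ 0) : bgB ε t * thetaMat ε t = 1 := by
  rw [bgB_eq ε ht, thetaMat_eq, smul_mul_smul_comm, cplxJ_mul_self]
  simp [ht]

lemma bgB_transpose (ε : ℤˣ) {t : ℝ} (ht : t ≠ 0) : (bgB ε t)ᵀ = -bgB ε t := by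
  rw [bgB_eq ε ht, transpose_smul, cplxJ_transpose, smul_neg]

/-! ### Algebra of the Seiberg-Witten map -/

section SeibergWittenAlgebra

variable {B θ F : M4}

lemma swMap_eq (hB : B * θ = 1) (h : IsUnit (B + F).det) :
    swMap θ F = B - B * (B + F)⁻¹ * B := by
  have e : 1 + F * θ = (B + F) * θ := by rw [add_mul, hB]
  have hi : θ⁻¹ = B := Matrix.inv_eq_left_inv hB
  rw [swMap, e, Matrix.mul_inv_rev, hi]
  have : B * (B + F)⁻¹ * F = B * ((B + F)⁻¹ * (B + F)) - B * (B + F)⁻¹ * B := by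
    noncomm_ring
  rw [this, Matrix.nonsing_inv_mul _ h, mul_one]

lemma one_sub_swMap_mul (hB : B * θ = 1) (h : IsUnit (B + F).det) :
    1 - swMap θ F * θ = B * (B + F)⁻¹ := by
  rw [swMap_eq hB h, sub_mul, hB, mul_assoc _ B θ, hB]; simp

lemma isUnit_det_mul_inv (hB : B * θ = 1) (h : IsUnit (B + F).det) :
    IsUnit (B * (B + F)⁻¹).det := by
  rw [det_mul]
  exact (Matrix.isUnit_det_of_right_inverse hB).mul (Matrix.isUnit_nonsing_inv_det _ h)

lemma swInv_swMap (hB : B * θ = 1) (h : IsUnit (B + F).det) :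
    swInv θ (swMap θ F) = F := by
  have hi : B⁻¹ = θ := Matrix.inv_eq_right_inv hB
  rw [swInv, one_sub_swMap_mul hB h, swMap_eq hB h, Matrix.mul_inv_rev, hi,
    Matrix.nonsing_inv_nonsing_inv _ h]
  have hB' : θ * B = 1 := mul_eq_one_comm.1 hB
  calc (B + F) * θ * (B - B * (B + F)⁻¹ * B)
      = (B + F) * (θ * B) - (B + F) * (θ * B) * (B + F)⁻¹ * B := by noncomm_ring
    _ = F := by rw [hB', mul_one, Matrix.mul_nonsing_inv _ h]; simp

end SeibergWittenAlgebra

/-! ### Closed two-forms in components -/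

lemma twoForm_apply (M : M4) (v : Fin 2 → R4) :
    twoForm M v = (1 / 2) * ∑ a, ∑ b, M a b * (v 0 a * v 1 b - v 0 b * v 1 a) := rfl

lemma twoForm_apply_skew {M : M4} (hM : Mᵀ = -M) (v : Fin 2 → R4) :
    twoForm M v = v 0 ⬝ᵥ (M *ᵥ v 1) := by
  have h : ∀ a b, M b a = -M a b := fun a b => congrFun (congrFun hM a) b
  have h0 : ∑ a, ∑ b, M a b * (v 0 b * v 1 a) = -∑ a, ∑ b, M a b * (v 0 a * v 1 b) := by
    rw [Finset.sum_comm, ← Finset.sum_neg_distrib]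
    refine Finset.sum_congr rfl fun a _ => ?_
    rw [← Finset.sum_neg_distrib]
    exact Finset.sum_congr rfl fun b _ => by rw [h a b]; ring
  have h1 : v 0 ⬝ᵥ (M *ᵥ v 1) = ∑ a, ∑ b, M a b * (v 0 a * v 1 b) := by
    simp only [dotProduct, mulVec, Finset.mul_sum]
    exact Finset.sum_congr rfl fun a _ => Finset.sum_congr rfl fun b _ => by ring
  rw [twoForm_apply, h1]
  simp only [mul_sub, Finset.sum_sub_distrib, h0]
  ring

lemma twoForm_single {M : M4} (hM : Mᵀ = -M) (b c : Fin 4) :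
    twoForm M ![Pi.single b 1, Pi.single c 1] = M b c := by
  simp [twoForm_apply_skew hM]

/-- The partial derivative `∂_i M` of a field of matrices, taken entrywise. -/
def matPd (i : Fin 4) (M : R4 → M4) (x : R4) : M4 := .of fun a b => pd i (fun z => M z a b) x

lemma twoForm_eq_sum (M : M4) :
    twoForm M = ∑ a, ∑ b, M a b • twoForm (Matrix.single a b 1) := by
  have h : ∀ (a b : Fin 4) (v : Fin 2 → R4), twoForm (Matrix.single a b 1) v =
      (1 / 2) * (v 0 a * v 1 b - v 0 b * v 1 a) := by
    intro a b v
    rw [twoForm_apply]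
    congr 1
    rw [Finset.sum_eq_single a, Finset.sum_eq_single b] <;>
      simp +contextual [Matrix.single_apply, eq_comm]
  ext v
  simp only [ContinuousAlternatingMap.sum_apply, ContinuousAlternatingMap.smul_apply, h,
    twoForm_apply M, Finset.mul_sum, smul_eq_mul]
  exact Finset.sum_congr rfl fun a _ => Finset.sum_congr rfl fun b _ => by ring

lemma differentiableAt_twoForm {M : R4 → M4} {x : R4}
    (hM : ∀ a b, DifferentiableAt ℝ (fun z => M z a b) x) :
    DifferentiableAt ℝ (fun z => twoForm (M z)) x := by
  have h : (fun z => twoForm (M z)) =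
      fun z => ∑ a, ∑ b, M z a b • twoForm (Matrix.single a b 1) :=
    funext fun z => twoForm_eq_sum (M z)
  rw [h]
  exact DifferentiableAt.fun_sum fun a _ => DifferentiableAt.fun_sum fun b _ =>
    (hM a b).smul_const _

open Filter Topology in
lemma pd_congr {u v : R4 → ℝ} {x : R4} (h : u =ᶠ[𝓝 x] v) (i : Fin 4) : pd i u x = pd i v x := by
  rw [pd, pd, h.fderiv_eq]

lemma extDeriv_twoForm_single {M : R4 → M4} {U : Set R4} (hU : IsOpen U)
    (hM : ∀ x ∈ U, ∀ a b, DifferentiableAt ℝ (fun z => M z a b) x)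
    (hs : ∀ x ∈ U, (M x)ᵀ = -M x) {x : R4} (hx : x ∈ U) (a b c : Fin 4) :
    extDeriv (fun z => twoForm (M z)) x ![Pi.single a 1, Pi.single b 1, Pi.single c 1] =
      matPd a M x b c + matPd b M x c a + matPd c M x a b := by
  have key : ∀ i p q : Fin 4,
      fderiv ℝ (fun z => twoForm (M z) ![Pi.single p 1, Pi.single q 1]) x (Pi.single i 1) =
        matPd i M x p q := fun i p q => pd_congr
    (Filter.eventually_of_mem (hU.mem_nhds hx) fun z hz => twoForm_single (hs z hz) p q) i
  have e0 : (0 : Fin 3).removeNth (![Pi.single a 1, Pi.single b 1, Pi.single c 1] : Fin 3 → R4) =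
      ![Pi.single b 1, Pi.single c 1] := by
    ext i; fin_cases i <;> rfl
  have e1 : (1 : Fin 3).removeNth (![Pi.single a 1, Pi.single b 1, Pi.single c 1] : Fin 3 → R4) =
      ![Pi.single a 1, Pi.single c 1] := by
    ext i; fin_cases i <;> rfl
  have e2 : (2 : Fin 3).removeNth (![Pi.single a 1, Pi.single b 1, Pi.single c 1] : Fin 3 → R4) =
      ![Pi.single a 1, Pi.single b 1] := by
    ext i; fin_cases i <;> rfl
  -- Skew-symmetry near `x` absorbs the sign of the middle term of the exterior derivative.
  have hsk : matPd b M x a c = -matPd b M x c a := by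
    have : pd b (fun z => M z a c) x = pd b (fun z => -M z c a) x :=
      pd_congr (Filter.eventually_of_mem (hU.mem_nhds hx) fun z hz =>
        congrFun (congrFun (hs z hz) c) a) b
    simpa [matPd, pd] using this
  rw [extDeriv_apply (differentiableAt_twoForm (hM x hx)), Fin.sum_univ_three, e0, e1, e2]
  simp only [cons_val_zero, cons_val_one, cons_val_two, key]
  have hc := key c a b
  simp_all

/-- The components of `dM` for a skew-symmetric `M` are the cyclic sums of `∂_a M_{bc}`. -/
lemma closedOn_iff {M : R4 → M4} {U : Set R4} (hU : IsOpen U)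
    (hM : ∀ x ∈ U, ∀ a b, DifferentiableAt ℝ (fun z => M z a b) x)
    (hs : ∀ x ∈ U, (M x)ᵀ = -M x) :
    ClosedOn M U ↔ ∀ x ∈ U, ∀ a b c,
      matPd a M x b c + matPd b M x c a + matPd c M x a b = 0 := by
  refine forall₂_congr fun x hx => ⟨fun h a b c => ?_, fun h => ?_⟩
  · rw [← extDeriv_twoForm_single hU hM hs hx, h]; rfl
  · refine ContinuousAlternatingMap.toAlternatingMap_injective
      (Module.Basis.ext_alternating (Pi.basisFun ℝ (Fin 4)) fun v _ => ?_)
    have hv : (fun i => Pi.basisFun ℝ (Fin 4) (v i)) =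
        ![Pi.single (v 0) 1, Pi.single (v 1) 1, Pi.single (v 2) 1] := by
      ext i : 1; fin_cases i <;> simp
    rw [hv]
    exact (extDeriv_twoForm_single hU hM hs hx _ _ _).trans (h _ _ _)

/-! ### Derivatives of matrix fields -/

section MatrixInverse

-- The choice of the norm is immaterial: `matPd` refers to the entries only. A normed algebra
-- structure is what the derivative of `Ring.inverse` requires.
attribute [local instance] Matrix.linftyOpNormedRing Matrix.linftyOpNormedAlgebra

lemma matPd_eq_fderiv {M : R4 → M4} {x : R4} (hM : DifferentiableAt ℝ M x) (i : Fin 4) :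
    matPd i M x = fderiv ℝ M x (Pi.single i 1) := by
  ext a b
  have := ((Matrix.entryLinearMap ℝ ℝ a b).toContinuousLinearMap.hasFDerivAt.comp x
    hM.hasFDerivAt).fderiv
  exact congrArg (· (Pi.single i 1)) this

lemma differentiableAt_matrix_iff {M : R4 → M4} {x : R4} :
    DifferentiableAt ℝ M x ↔ ∀ a b, DifferentiableAt ℝ (fun z => M z a b) x := by
  refine ⟨fun h a b => ?_, fun h => ?_⟩
  · exact (Matrix.entryLinearMap ℝ ℝ a b).toContinuousLinearMap.differentiableAt.comp x h
  · have : M = fun z => ∑ a, ∑ b, M z a b • (Matrix.single a b 1 : M4) := by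
      funext z
      conv_lhs => rw [Matrix.matrix_eq_sum_single (M z)]
      simp
    rw [this]
    exact DifferentiableAt.fun_sum fun a _ => DifferentiableAt.fun_sum fun b _ =>
      (h a b).smul_const _

lemma differentiableAt_matrix_inv {M : R4 → M4} {x : R4}
    (hM : ∀ a b, DifferentiableAt ℝ (fun z => M z a b) x) (hx : IsUnit (M x).det) (a b : Fin 4) :
    DifferentiableAt ℝ (fun z => (M z)⁻¹ a b) x := by
  have hu : IsUnit (M x) := (Matrix.isUnit_iff_isUnit_det _).2 hx
  refine differentiableAt_matrix_iff.1 ?_ a b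
  simp_rw [Matrix.nonsing_inv_eq_ringInverse]
  exact (differentiableAt_inverse hu).comp x (differentiableAt_matrix_iff.2 hM)

lemma matPd_const_sub_mul_mul {M : R4 → M4} {x : R4}
    (hM : ∀ a b, DifferentiableAt ℝ (fun z => M z a b) x) (A C D : M4) (i : Fin 4) :
    matPd i (fun z => C - A * M z * D) x = -(A * matPd i M x * D) := by
  have hd := differentiableAt_matrix_iff.2 hM
  have h2 := ((hd.hasFDerivAt.const_mul A).mul_const' D).const_sub C
  rw [matPd_eq_fderiv h2.differentiableAt, matPd_eq_fderiv hd]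
  exact congrArg (· (Pi.single i 1)) h2.fderiv

lemma matPd_inv {M : R4 → M4} {x : R4}
    (hM : ∀ a b, DifferentiableAt ℝ (fun z => M z a b) x) (hx : IsUnit (M x).det) (i : Fin 4) :
    matPd i (fun z => (M z)⁻¹) x = -((M x)⁻¹ * matPd i M x * (M x)⁻¹) := by
  have hu : IsUnit (M x) := (Matrix.isUnit_iff_isUnit_det _).2 hx
  obtain ⟨w, hw⟩ := hu
  have hd := differentiableAt_matrix_iff.2 hM
  have h1 := hasFDerivAt_ringInverse (𝕜 := ℝ) w
  rw [hw] at h1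
  have h2 := h1.comp x hd.hasFDerivAt
  have hi : (↑w⁻¹ : M4) = (M x)⁻¹ := by rw [← hw, Matrix.coe_units_inv]
  have he : (fun z => (M z)⁻¹) = Ring.inverse ∘ M := by
    funext z; exact Matrix.nonsing_inv_eq_ringInverse _
  rw [he, matPd_eq_fderiv h2.differentiableAt, matPd_eq_fderiv hd, ← hi]
  exact congrArg (· (Pi.single i 1)) h2.fderiv

end MatrixInverse

/-! ### Cyclic sums of tensors with three indices -/

/-- The action of a matrix `P` on all three indices of the tensor `T_{qpr} = T q p r`; see
`triAct_apply` for the symmetric form. -/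
def triAct (P : M4) (T : Fin 4 → M4) (a : Fin 4) : M4 := ∑ q, P a q • (P * T q * Pᵀ)

lemma triAct_apply (P : M4) (T : Fin 4 → M4) (a b c : Fin 4) :
    triAct P T a b c = ∑ q, ∑ p, ∑ r, P a q * P b p * P c r * T q p r := by
  simp only [triAct, Matrix.sum_apply, Matrix.smul_apply, Matrix.mul_apply, smul_eq_mul,
    Matrix.transpose_apply, Finset.sum_mul, Finset.mul_sum]
  refine Finset.sum_congr rfl fun q _ => ?_
  rw [Finset.sum_comm]
  exact Finset.sum_congr rfl fun p _ => Finset.sum_congr rfl fun r _ => by ring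

lemma triAct_triAct (P Q : M4) (T : Fin 4 → M4) : triAct P (triAct Q T) = triAct (P * Q) T := by
  funext a
  simp only [triAct, Finset.mul_sum, Finset.sum_mul, Finset.smul_sum, Matrix.mul_apply,
    Finset.sum_smul, transpose_mul]
  rw [Finset.sum_comm]
  refine Finset.sum_congr rfl fun r _ => Finset.sum_congr rfl fun q _ => ?_
  rw [mul_smul_comm, smul_mul_assoc, smul_smul]
  congr 1
  noncomm_ring

lemma triAct_one (T : Fin 4 → M4) : triAct 1 T = T := by
  funext a
  simp [triAct, Matrix.one_apply]

lemma triAct_cyclic (P : M4) (T : Fin 4 → M4) (a b c : Fin 4) :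
    triAct P T a b c + triAct P T b c a + triAct P T c a b =
      ∑ q, ∑ p, ∑ r, P a q * P b p * P c r * (T q p r + T p r q + T r q p) := by
  simp only [mul_add, Finset.sum_add_distrib, triAct_apply]
  congr 1
  · congr 1
    rw [Finset.sum_comm_cycle]
    exact Finset.sum_congr rfl fun q _ => Finset.sum_congr rfl fun p _ =>
      Finset.sum_congr rfl fun r _ => by ring
  · rw [← Finset.sum_comm_cycle]
    exact Finset.sum_congr rfl fun q _ => Finset.sum_congr rfl fun p _ =>
      Finset.sum_congr rfl fun r _ => by ring

/-- An invertible change of basis preserves the vanishing of the cyclic sum. -/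
lemma triAct_cyclic_eq_zero_iff {P : M4} (hP : IsUnit P.det) (T : Fin 4 → M4) :
    (∀ a b c, triAct P T a b c + triAct P T b c a + triAct P T c a b = 0) ↔
      ∀ a b c, T a b c + T b c a + T c a b = 0 := by
  have key : ∀ (Q : M4) (S : Fin 4 → M4), (∀ a b c, S a b c + S b c a + S c a b = 0) →
      ∀ a b c, triAct Q S a b c + triAct Q S b c a + triAct Q S c a b = 0 := by
    intro Q S h a b c
    simp [triAct_cyclic, h]
  refine ⟨fun h => ?_, key P T⟩
  -- Acting by `P⁻¹` undoes the action of `P`.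
  have := key P⁻¹ _ h
  rwa [triAct_triAct, Matrix.nonsing_inv_mul _ hP, triAct_one] at this

/-! ### Brackets and covariant coordinates -/

/-- The gradient of a function, as the column vector of its partial derivatives. -/
def grad (u : R4 → ℝ) (x : R4) : R4 := fun i => pd i u x

lemma bracket_eq (P : R4 → M4) (u v : R4 → ℝ) (x : R4) :
    bracket P u v x = grad u x ⬝ᵥ (P x *ᵥ grad v x) := by
  simp only [bracket, grad, dotProduct, mulVec, Finset.mul_sum]
  exact Finset.sum_congr rfl fun a _ => Finset.sum_congr rfl fun b _ => by ring

lemma hasFDerivAt_covCoord (B : M4) (a : Fin 4) (x : R4) :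
    HasFDerivAt (covCoord B a)
      ((ContinuousLinearMap.proj a).comp (Matrix.mulVecLin B).toContinuousLinearMap) x :=
  ((ContinuousLinearMap.proj (R := ℝ) (φ := fun _ : Fin 4 => ℝ) a).comp
    (Matrix.mulVecLin B).toContinuousLinearMap).hasFDerivAt

lemma grad_covCoord (B : M4) (a : Fin 4) (x : R4) : grad (covCoord B a) x = B a := by
  funext i
  simp [grad, pd, (hasFDerivAt_covCoord B a x).fderiv]

lemma covD_eq (B : M4) (F : R4 → M4) (a : Fin 4) (h : R4 → ℝ) (x : R4) :
    covD B F a h x = ((B * (B + F x)⁻¹) *ᵥ grad h x) a := by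
  rw [covD, bracket_eq, grad_covCoord, ← mulVec_mulVec]
  rfl

/-- The commutator of covariant coordinates: the right side is the Seiberg-Witten image of `F`. -/
lemma add_bracket_covCoord {B : M4} (hB : Bᵀ = -B) (F : R4 → M4) (a b : Fin 4) (x : R4) :
    B a b + bracket (bivec B F) (covCoord B a) (covCoord B b) x =
      (B - B * (B + F x)⁻¹ * B) a b := by
  have h : bracket (bivec B F) (covCoord B a) (covCoord B b) x = (B * (B + F x)⁻¹ * Bᵀ) a b := by
    rw [← covD, covD_eq, grad_covCoord]
    rfl
  rw [h, hB]
  simp [sub_eq_add_neg]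

/-! ### Darboux coordinates -/

/-- The Jacobian matrix `∂x^i / ∂y^j` of a map. -/
def jacobian (φ : R4 → R4) (y : R4) : M4 := LinearMap.toMatrix' (fderiv ℝ φ y : R4 →ₗ[ℝ] R4)

lemma fderiv_eq_jacobian_mulVec (φ : R4 → R4) (y v : R4) :
    fderiv ℝ φ y v = jacobian φ y *ᵥ v := by
  simp [jacobian, LinearMap.toMatrix'_mulVec]

lemma fderiv_eq_grad_dotProduct (u : R4 → ℝ) (x v : R4) :
    fderiv ℝ u x v = v ⬝ᵥ grad u x := by
  conv_lhs => rw [pi_eq_sum_univ' v]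
  simp [grad, pd, dotProduct]

lemma grad_comp {k : R4 → ℝ} {φ : R4 → R4} {y : R4} (hk : DifferentiableAt ℝ k (φ y))
    (hφ : DifferentiableAt ℝ φ y) :
    grad (fun z => k (φ z)) y = (jacobian φ y)ᵀ *ᵥ grad k (φ y) := by
  funext i
  have := congrArg (· (Pi.single i 1)) (fderiv_comp y hk hφ)
  refine this.trans ?_
  simp only [ContinuousLinearMap.comp_apply]
  rw [fderiv_eq_jacobian_mulVec, fderiv_eq_grad_dotProduct, mulVec_single_one]
  rfl

lemma grad_gaugeField {B : M4} {φ : R4 → R4} {y : R4} (hφ : DifferentiableAt ℝ φ y) (μ : Fin 4) :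
    grad (gaugeField B φ μ) y = (B * jacobian φ y - B) μ := by
  have h1 := grad_comp (hasFDerivAt_covCoord B μ (φ y)).differentiableAt hφ
  have h2 : grad (gaugeField B φ μ) y =
      grad (fun z => covCoord B μ (φ z)) y - grad (covCoord B μ) y := by
    funext i
    have := fderiv_fun_sub
      ((hasFDerivAt_covCoord B μ (φ y)).differentiableAt.fun_comp' y hφ)
      (hasFDerivAt_covCoord B μ y).differentiableAt
    exact congrArg (· (Pi.single i 1)) this
  rw [h2, h1, grad_covCoord, grad_covCoord, mulVec_transpose]
  rfl

/-- A linear map that pulls `Ω` back to `B` pushes the bivector `θ = B⁻¹` forward to `Ω⁻¹`. -/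
lemma darboux_jacobian {B θ Ω A : M4} (hB : B * θ = 1) (h : Aᵀ * Ω * A = B) :
    Ω⁻¹ = A * θ * Aᵀ := by
  refine Matrix.inv_eq_right_inv ?_
  have h1 : Aᵀ * (Ω * A * θ) = 1 := by rw [← hB, ← h]; noncomm_ring
  have := mul_eq_one_comm.1 h1
  rw [← this]; noncomm_ring

/-- The pullback condition of a Darboux transformation, in terms of the Jacobian matrix. -/
lemma jacobian_pullback {B : M4} {F : R4 → M4} {φ : R4 → R4} {y : R4} (hB : Bᵀ = -B)
    (hF : (F (φ y))ᵀ = -F (φ y))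
    (h : (twoForm (B + F (φ y))).compContinuousLinearMap (fderiv ℝ φ y) = twoForm B) :
    (jacobian φ y)ᵀ * (B + F (φ y)) * jacobian φ y = B := by
  have hω : (B + F (φ y))ᵀ = -(B + F (φ y)) := by rw [transpose_add, hB, hF]; abel
  ext b c
  have := congrArg (fun η => η ![Pi.single b 1, Pi.single c 1]) h
  simp only [ContinuousAlternatingMap.compContinuousLinearMap_apply] at this
  rw [twoForm_single hB, twoForm_apply_skew hω] at this
  rw [← this]
  simp only [Function.comp_apply, cons_val_zero, cons_val_one, fderiv_eq_jacobian_mulVec,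
    mulVec_single_one]
  rw [mul_assoc]
  rfl

lemma fieldStrength_gaugeField {B θ : M4} {φ : R4 → R4} {y : R4} (hBθ : B * θ = 1)
    (hB : Bᵀ = -B) (hφ : DifferentiableAt ℝ φ y) :
    fieldStrength θ (gaugeField B φ) y =
      B - B * (jacobian φ y * θ * (jacobian φ y)ᵀ) * B := by
  set A := jacobian φ y with hA
  have e : fieldStrength θ (gaugeField B φ) y =
      (B * A - B)ᵀ - (B * A - B) + (B * A - B) * θ * (B * A - B)ᵀ := by
    ext μ ν
    have hg := fun κ => grad_gaugeField (B := B) hφ κ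
    have h1 : pd μ (gaugeField B φ ν) y = (B * A - B) ν μ := congrFun (hg ν) μ
    have h2 : pd ν (gaugeField B φ μ) y = (B * A - B) μ ν := congrFun (hg μ) ν
    simp only [fieldStrength, of_apply, h1, h2, bracket_eq, hg, ← hA, Matrix.add_apply,
      Matrix.sub_apply, transpose_apply]
    congr 1
    rw [dotProduct_mulVec]
    rfl
  have hθB : θ * B = 1 := mul_eq_one_comm.1 hBθ
  rw [e, transpose_sub, transpose_mul, hB]
  have h3 : (B * A - B) * θ * (Aᵀ * -B - -B) =
      -(B * (A * θ * Aᵀ) * B) + B * A * (θ * B) + (B * θ) * Aᵀ * B - (B * θ) * B := by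
    noncomm_ring
  rw [h3, hθB, hBθ]
  noncomm_ring

/-- `D_μ = ∂_μ + {a_μ, ·}_θ` is the bracket with `B_{μν} x^ν(y)`: the term `∂_μ` is the bracket with
`B_{μν} y^ν`. -/
lemma gaugeD_gaugeField {B θ : M4} {φ : R4 → R4} {y : R4} (hBθ : B * θ = 1)
    (hφ : DifferentiableAt ℝ φ y) (μ : Fin 4) (h : R4 → ℝ) :
    gaugeD θ (gaugeField B φ) μ h y = ((B * jacobian φ y * θ) *ᵥ grad h y) μ := by
  have h1 : bracket (fun _ => θ) (gaugeField B φ μ) h y =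
      (((B * jacobian φ y - B) * θ) *ᵥ grad h y) μ := by
    rw [bracket_eq, grad_gaugeField hφ, ← mulVec_mulVec]
    rfl
  rw [gaugeD, h1, sub_mul, hBθ, sub_mulVec, one_mulVec]
  simp [grad]

lemma gaugeD_comp {B θ : M4} {F : R4 → M4} {φ : R4 → R4} {y : R4} (hBθ : B * θ = 1)
    (hφ : DifferentiableAt ℝ φ y)
    (hΘ : (B + F (φ y))⁻¹ = jacobian φ y * θ * (jacobian φ y)ᵀ)
    {k : R4 → ℝ} (hk : DifferentiableAt ℝ k (φ y)) (a : Fin 4) :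
    gaugeD θ (gaugeField B φ) a (fun z => k (φ z)) y = covD B F a k (φ y) := by
  rw [gaugeD_gaugeField hBθ hφ, covD_eq, hΘ, grad_comp hk hφ, mulVec_mulVec]
  simp only [mul_assoc]

lemma gaugeD_congr {θ : M4} {A : Fin 4 → R4 → ℝ} {h k : R4 → ℝ} {y : R4}
    (e : h =ᶠ[nhds y] k) (a : Fin 4) : gaugeD θ A a h y = gaugeD θ A a k y := by
  simp only [gaugeD, bracket, pd_congr e]

/-! ### The Bianchi identity and closedness of `F` -/

section Bianchi

variable {B θ : M4} {F : R4 → M4} {U : Set R4}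

lemma swMap_eventuallyEq (hBθ : B * θ = 1) (hU : IsOpen U)
    (hdet : ∀ x ∈ U, IsUnit (B + F x).det) {x : R4} (hx : x ∈ U) (b c : Fin 4) :
    (fun z => swMap θ (F z) b c) =ᶠ[nhds x] fun z => (B - B * (B + F z)⁻¹ * B) b c :=
  Filter.eventually_of_mem (hU.mem_nhds hx) fun z hz => by
    simp only [swMap_eq hBθ (hdet z hz)]

lemma differentiableAt_const_add {x : R4}
    (hd : ∀ a b, DifferentiableAt ℝ (fun z => F z a b) x) (a b : Fin 4) :
    DifferentiableAt ℝ (fun z => (B + F z) a b) x :=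
  (hd a b).const_add (B a b)

lemma differentiableAt_swMap (hBθ : B * θ = 1) (hU : IsOpen U)
    (hdet : ∀ x ∈ U, IsUnit (B + F x).det)
    (hd : ∀ x ∈ U, ∀ a b, DifferentiableAt ℝ (fun z => F z a b) x) {x : R4} (hx : x ∈ U)
    (b c : Fin 4) : DifferentiableAt ℝ (fun z => swMap θ (F z) b c) x := by
  rw [(swMap_eventuallyEq hBθ hU hdet hx b c).differentiableAt_iff]
  have := differentiableAt_matrix_inv (differentiableAt_const_add (B := B) (hd x hx)) (hdet x hx)
  simp only [Matrix.sub_apply, Matrix.mul_apply]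
  exact (DifferentiableAt.fun_sum fun j _ => (DifferentiableAt.fun_sum fun k _ =>
    (this k j).const_mul _).mul_const _).const_sub _

lemma matPd_swMap (hBθ : B * θ = 1) (hB : Bᵀ = -B) (hU : IsOpen U)
    (hdet : ∀ x ∈ U, IsUnit (B + F x).det) (hs : ∀ x ∈ U, (F x)ᵀ = -F x)
    (hd : ∀ x ∈ U, ∀ a b, DifferentiableAt ℝ (fun z => F z a b) x) {x : R4} (hx : x ∈ U)
    (q : Fin 4) :
    matPd q (fun z => swMap θ (F z)) x =
      (B * (B + F x)⁻¹) * matPd q F x * (B * (B + F x)⁻¹)ᵀ := by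
  have h1 : matPd q (fun z => swMap θ (F z)) x =
      matPd q (fun z => B - B * (B + F z)⁻¹ * B) x := by
    ext b c; exact pd_congr (swMap_eventuallyEq hBθ hU hdet hx b c) q
  have h2 : matPd q (fun z => B + F z) x = matPd q F x := by
    ext b c
    simp [matPd, pd]
  have ht : (B * (B + F x)⁻¹)ᵀ = (B + F x)⁻¹ * B := by
    have : (B + F x)ᵀ = -(B + F x) := by rw [transpose_add, hB, hs x hx]; abel
    rw [transpose_mul, transpose_nonsing_inv, this, hB,
      Matrix.inv_eq_right_inv (B := -(B + F x)⁻¹), neg_mul_neg]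
    rw [neg_mul_neg, Matrix.mul_nonsing_inv _ (hdet x hx)]
  have hc := differentiableAt_const_add (B := B) (hd x hx)
  rw [h1, matPd_const_sub_mul_mul (differentiableAt_matrix_inv hc (hdet x hx)),
    matPd_inv hc (hdet x hx), h2, ht]
  noncomm_ring

lemma covD_swMap (hBθ : B * θ = 1) (hB : Bᵀ = -B) (hU : IsOpen U)
    (hdet : ∀ x ∈ U, IsUnit (B + F x).det) (hs : ∀ x ∈ U, (F x)ᵀ = -F x)
    (hd : ∀ x ∈ U, ∀ a b, DifferentiableAt ℝ (fun z => F z a b) x) {x : R4} (hx : x ∈ U)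
    (a b c : Fin 4) :
    covD B F a (fun z => swMap θ (F z) b c) x =
      triAct (B * (B + F x)⁻¹) (fun q => matPd q F x) a b c := by
  simp only [covD_eq, triAct, Matrix.sum_apply, mulVec, dotProduct]
  refine Finset.sum_congr rfl fun q _ => ?_
  rw [← matPd_swMap hBθ hB hU hdet hs hd hx]
  rfl

lemma bianchiOn_swMap_iff_closedOn (hBθ : B * θ = 1) (hB : Bᵀ = -B) (hU : IsOpen U)
    (hdet : ∀ x ∈ U, IsUnit (B + F x).det) (hs : ∀ x ∈ U, (F x)ᵀ = -F x)
    (hd : ∀ x ∈ U, ∀ a b, DifferentiableAt ℝ (fun z => F z a b) x) :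
    BianchiOn (covD B F) (fun x => swMap θ (F x)) U ↔ ClosedOn F U := by
  rw [closedOn_iff hU hd hs]
  refine forall₂_congr fun x hx => ?_
  simp only [covD_swMap hBθ hB hU hdet hs hd hx]
  exact triAct_cyclic_eq_zero_iff (isUnit_det_mul_inv hBθ (hdet x hx)) _

end Bianchi

/-! ### Hermitian metrics -/

section HermitianMetric

variable {ε : ℤˣ} {t : ℝ} {U : Set R4} {g F : R4 → M4}

lemma cplxJ_mul_metric (hg : IsHermitianMetricOn (cplxJ ε) g U) {x : R4} (hx : x ∈ U) :
    cplxJ ε * g x = g x * cplxJ ε := by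
  have h := hg.compat x hx
  rw [cplxJ_transpose] at h
  calc cplxJ ε * g x = -cplxJ ε * g x * (cplxJ ε * cplxJ ε) := by rw [cplxJ_mul_self]; simp
    _ = -cplxJ ε * g x * cplxJ ε * cplxJ ε := by noncomm_ring
    _ = g x * cplxJ ε := by rw [h]

lemma fluctuation_eq (ht : t ≠ 0)
    (hF : ∀ x ∈ U, F x = (1 / 2 : ℝ) • ((g x - 1) * (thetaMat ε t)⁻¹)) {x : R4} (hx : x ∈ U) :
    F x = (1 / 2 * t⁻¹) • (g x * cplxJ ε - cplxJ ε) := by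
  rw [hF x hx, ← bgB, bgB_eq ε ht, mul_smul_comm, smul_smul, sub_mul, one_mul]

/-- `F` is skew-symmetric because `g` is symmetric and commutes with `J`. -/
lemma fluctuation_transpose (ht : t ≠ 0) (hg : IsHermitianMetricOn (cplxJ ε) g U)
    (hF : ∀ x ∈ U, F x = (1 / 2 : ℝ) • ((g x - 1) * (thetaMat ε t)⁻¹)) {x : R4} (hx : x ∈ U) :
    (F x)ᵀ = -F x := by
  rw [fluctuation_eq ht hF hx, transpose_smul, transpose_sub, transpose_mul, cplxJ_transpose,
    hg.symm x hx, neg_mul, cplxJ_mul_metric hg hx, ← smul_neg]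
  congr 1
  abel

lemma fundForm_eq (ht : t ≠ 0) (hg : IsHermitianMetricOn (cplxJ ε) g U)
    (hF : ∀ x ∈ U, F x = (1 / 2 : ℝ) • ((g x - 1) * (thetaMat ε t)⁻¹)) {x : R4} (hx : x ∈ U) :
    fundForm (cplxJ ε) g x = (-(2 * t)) • F x - cplxJ ε := by
  rw [fluctuation_eq ht hF hx, fundForm, cplxJ_transpose, neg_mul, cplxJ_mul_metric hg hx,
    smul_smul]
  have : -(2 * t) * (1 / 2 * t⁻¹) = -1 := by field_simp
  rw [this]
  simp

/-- `B + F = ½ (g + 1) B`. -/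
lemma isUnit_det_bgB_add (ht : t ≠ 0) (hg1 : ∀ x ∈ U, (g x + 1).det ≠ 0)
    (hF : ∀ x ∈ U, F x = (1 / 2 : ℝ) • ((g x - 1) * (thetaMat ε t)⁻¹)) {x : R4} (hx : x ∈ U) :
    IsUnit (bgB ε t + F x).det := by
  have h : bgB ε t + F x = (1 / 2 : ℝ) • ((g x + 1) * bgB ε t) := by
    rw [hF x hx, ← bgB]
    simp only [sub_mul, add_mul, one_mul]
    module
  have hB := (Matrix.isUnit_det_of_right_inverse (bgB_mul_thetaMat ε ht)).ne_zero
  rw [h, det_smul, det_mul]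
  exact isUnit_iff_ne_zero.2 (mul_ne_zero (by positivity) (mul_ne_zero (hg1 x hx) hB))

lemma fluctuation_differentiableAt (hU : IsOpen U) (hg : IsHermitianMetricOn (cplxJ ε) g U)
    (hF : ∀ x ∈ U, F x = (1 / 2 : ℝ) • ((g x - 1) * (thetaMat ε t)⁻¹)) {x : R4} (hx : x ∈ U)
    (a b : Fin 4) : DifferentiableAt ℝ (fun z => F z a b) x := by
  have hgd : ∀ a b, DifferentiableAt ℝ (fun z => g z a b) x := fun a b =>
    ((hg.smooth a b).contDiffAt (hU.mem_nhds hx)).differentiableAt (by simp)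
  have e : (fun z => F z a b) =ᶠ[nhds x]
      fun z => ((1 / 2 : ℝ) • ((g z - 1) * (thetaMat ε t)⁻¹)) a b :=
    Filter.eventually_of_mem (hU.mem_nhds hx) fun z hz => by simp only [hF z hz]
  rw [e.differentiableAt_iff]
  simp only [Matrix.smul_apply, Matrix.mul_apply, Matrix.sub_apply, smul_eq_mul]
  exact (DifferentiableAt.fun_sum fun j _ => ((hgd a j).sub_const _).mul_const _).const_mul _

lemma isKahlerOn_iff_closedOn (ht : t ≠ 0) (hU : IsOpen U)
    (hg : IsHermitianMetricOn (cplxJ ε) g U)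
    (hF : ∀ x ∈ U, F x = (1 / 2 : ℝ) • ((g x - 1) * (thetaMat ε t)⁻¹)) :
    IsKahlerOn (cplxJ ε) g U ↔ ClosedOn F U := by
  have hs : ∀ x ∈ U, (F x)ᵀ = -F x := fun x hx => fluctuation_transpose ht hg hF hx
  have hd : ∀ x ∈ U, ∀ a b, DifferentiableAt ℝ (fun z => F z a b) x := fun x hx =>
    fluctuation_differentiableAt hU hg hF hx
  have e : ∀ x ∈ U, ∀ a b, (fun z => fundForm (cplxJ ε) g z a b) =ᶠ[nhds x]
      fun z => -(2 * t) * F z a b - cplxJ ε a b := fun x hx a b =>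
    Filter.eventually_of_mem (hU.mem_nhds hx) fun z hz => by
      simp only [fundForm_eq ht hg hF hz, Matrix.sub_apply, Matrix.smul_apply, smul_eq_mul]
  have hp : ∀ x ∈ U, ∀ i, matPd i (fundForm (cplxJ ε) g) x = -(2 * t) • matPd i F x := by
    intro x hx i
    ext a b
    simp only [matPd, of_apply, Matrix.smul_apply]
    rw [pd_congr (e x hx a b), pd, fderiv_sub_const, fderiv_const_mul (hd x hx a b)]
    rfl
  rw [IsKahlerOn, and_iff_right hg, closedOn_iff hU hd hs, closedOn_iff hU]
  · refine forall₂_congr fun x hx => forall_congr' fun a => forall_congr' fun b =>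
      forall_congr' fun c => ?_
    simp only [hp x hx, Matrix.smul_apply, ← smul_add]
    simp [ht]
  · intro x hx a b
    rw [(e x hx a b).differentiableAt_iff]
    exact ((hd x hx a b).const_mul _).sub_const _
  · intro x hx
    rw [fundForm_eq ht hg hF hx, transpose_sub, transpose_smul, hs x hx, cplxJ_transpose]
    simp only [smul_neg]
    abel

end HermitianMetric

/-! ### Symplectic gauge fields of Darboux transformations -/

section Darboux

variable {B θ : M4} {F : R4 → M4} {U V : Set R4} {φ : R4 → R4}

lemma IsDarboux.differentiableAt (hV : IsOpen V) (hφ : IsDarboux B F φ V U) {y : R4}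
    (hy : y ∈ V) : DifferentiableAt ℝ φ y :=
  (hφ.smooth.contDiffAt (hV.mem_nhds hy)).differentiableAt (by simp)

lemma IsDarboux.inv_eq (hBθ : B * θ = 1) (hB : Bᵀ = -B) (hs : ∀ x ∈ U, (F x)ᵀ = -F x)
    (hφ : IsDarboux B F φ V U) {y : R4} (hy : y ∈ V) :
    (B + F (φ y))⁻¹ = jacobian φ y * θ * (jacobian φ y)ᵀ :=
  darboux_jacobian hBθ
    (jacobian_pullback hB (hs _ (hφ.bijOn.mapsTo hy)) (hφ.pullback y hy))

lemma IsDarboux.fieldStrength_eq (hBθ : B * θ = 1) (hB : Bᵀ = -B)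
    (hdet : ∀ x ∈ U, IsUnit (B + F x).det) (hs : ∀ x ∈ U, (F x)ᵀ = -F x) (hV : IsOpen V)
    (hφ : IsDarboux B F φ V U) {y : R4} (hy : y ∈ V) :
    fieldStrength θ (gaugeField B φ) y = swMap θ (F (φ y)) := by
  rw [fieldStrength_gaugeField hBθ hB (hφ.differentiableAt hV hy),
    ← hφ.inv_eq hBθ hB hs hy, swMap_eq hBθ (hdet _ (hφ.bijOn.mapsTo hy))]

lemma IsDarboux.gaugeD_fieldStrength (hBθ : B * θ = 1) (hB : Bᵀ = -B) (hU : IsOpen U)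
    (hdet : ∀ x ∈ U, IsUnit (B + F x).det) (hs : ∀ x ∈ U, (F x)ᵀ = -F x)
    (hd : ∀ x ∈ U, ∀ a b, DifferentiableAt ℝ (fun z => F z a b) x) (hV : IsOpen V)
    (hφ : IsDarboux B F φ V U) {y : R4} (hy : y ∈ V) (a b c : Fin 4) :
    gaugeD θ (gaugeField B φ) a (fun z => fieldStrength θ (gaugeField B φ) z b c) y =
      covD B F a (fun x => swMap θ (F x) b c) (φ y) := by
  have e : (fun z => fieldStrength θ (gaugeField B φ) z b c) =ᶠ[nhds y]
      fun z => swMap θ (F (φ z)) b c :=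
    Filter.eventually_of_mem (hV.mem_nhds hy) fun z hz => by
      simp only [hφ.fieldStrength_eq hBθ hB hdet hs hV hz]
  rw [gaugeD_congr e]
  exact gaugeD_comp hBθ (hφ.differentiableAt hV hy) (hφ.inv_eq hBθ hB hs hy)
    (differentiableAt_swMap hBθ hU hdet hd (hφ.bijOn.mapsTo hy) b c) a

end Darboux

end SWKahler

end

theorem mainTheorem3 (ε : ℤˣ) (t : ℝ) (ht : t ≠ 0) (U : Set R4) (hU : IsOpen U)
    (g F : R4 → M4)
    (hg : IsHermitianMetricOn (cplxJ ε) g U)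
    (hg1 : ∀ x ∈ U, (g x + 1).det ≠ 0)
    (hF : ∀ x ∈ U, F x = (1 / 2 : ℝ) • ((g x - 1) * (thetaMat ε t)⁻¹)) :
    -- the Kähler condition is `dF = 0`
    (IsKahlerOn (cplxJ ε) g U ↔ ClosedOn F U) ∧
    -- the Kähler condition is the Bianchi identity for `f = (1 + F θ)⁻¹ F`
    (IsKahlerOn (cplxJ ε) g U ↔
      BianchiOn (covD (bgB ε t) F)
        (fun x => swMap (thetaMat ε t) (F x)) U) ∧
    -- `f` is the field strength of the covariant coordinates, and `F` is recovered from `f`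
    (∀ x ∈ U,
      (∀ a b, swMap (thetaMat ε t) (F x) a b =
        bgB ε t a b + bracket (bivec (bgB ε t) F)
          (covCoord (bgB ε t) a) (covCoord (bgB ε t) b) x) ∧
      (1 - swMap (thetaMat ε t) (F x) * thetaMat ε t).det ≠ 0 ∧
      F x = swInv (thetaMat ε t)
        (swMap (thetaMat ε t) (F x))) ∧
    -- in Darboux coordinates all this is the theory of a symplectic gauge field
    (∀ (V : Set R4) (φ : R4 → R4), IsOpen V →
      IsDarboux (bgB ε t) F φ V U →
      (∀ y ∈ V,
        fieldStrength (thetaMat ε t)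
            (gaugeField (bgB ε t) φ) y =
          swMap (thetaMat ε t) (F (φ y)) ∧
        F (φ y) = swInv (thetaMat ε t)
          (fieldStrength (thetaMat ε t)
            (gaugeField (bgB ε t) φ) y) ∧
        ∀ (a b c : Fin 4),
          gaugeD (thetaMat ε t) (gaugeField (bgB ε t) φ) a
              (fun z => fieldStrength (thetaMat ε t)
                (gaugeField (bgB ε t) φ) z b c) y =
            covD (bgB ε t) F a
              (fun x => swMap (thetaMat ε t) (F x) b c) (φ y)) ∧
      (IsKahlerOn (cplxJ ε) g U ↔
        BianchiOn
          (gaugeD (thetaMat ε t) (gaugeField (bgB ε t) φ))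
          (fieldStrength (thetaMat ε t)
            (gaugeField (bgB ε t) φ)) V)) := by
  have hBθ := bgB_mul_thetaMat ε ht
  have hB := bgB_transpose ε ht
  have hs : ∀ x ∈ U, (F x)ᵀ = -F x := fun x hx => fluctuation_transpose ht hg hF hx
  have hd : ∀ x ∈ U, ∀ a b, DifferentiableAt ℝ (fun z => F z a b) x := fun x hx =>
    fluctuation_differentiableAt hU hg hF hx
  have hdet : ∀ x ∈ U, IsUnit (bgB ε t + F x).det := fun x hx =>
    isUnit_det_bgB_add ht hg1 hF hx
  have hK := isKahlerOn_iff_closedOn ht hU hg hF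
  have hK' := hK.trans (bianchiOn_swMap_iff_closedOn hBθ hB hU hdet hs hd).symm
  refine ⟨hK, hK', fun x hx => ⟨fun a b => ?_, ?_, ?_⟩, fun V φ hV hφ => ⟨fun y hy => ?_, ?_⟩⟩
  · rw [add_bracket_covCoord hB, swMap_eq hBθ (hdet x hx)]
  · rw [one_sub_swMap_mul hBθ (hdet x hx)]
    exact (isUnit_det_mul_inv hBθ (hdet x hx)).ne_zero
  · exact (swInv_swMap hBθ (hdet x hx)).symm
  · have hf := hφ.fieldStrength_eq hBθ hB hdet hs hV hy
    refine ⟨hf, ?_, hφ.gaugeD_fieldStrength hBθ hB hU hdet hs hd hV hy⟩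
    rw [hf, swInv_swMap hBθ (hdet _ (hφ.bijOn.mapsTo hy))]
  · rw [hK']
    -- The two identities agree at `y` and `φ y`, and every point of `U` is such a `φ y`.
    refine ⟨fun h y hy a b c => ?_, fun h x hx a b c => ?_⟩
    · simp only [hφ.gaugeD_fieldStrength hBθ hB hU hdet hs hd hV hy]
      exact h _ (hφ.bijOn.mapsTo hy) a b c
    · obtain ⟨y, hy, rfl⟩ := hφ.bijOn.surjOn hx
      simpa only [hφ.gaugeD_fieldStrength hBθ hB hU hdet hs hd hV hy] using h y hy a b c
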